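/- Let $\Phi$ be an irreducible, reduced, crystallographic root system in a finite-dimensional $\mathbb{Q}$-vector space $E$, with Weyl group $W$ and coroots $\alpha^\vee$ ($\alpha\in\Phi$), and write $(v,\alpha^\vee)\in\mathbb{Q}$ for the pairing of $v\in E$ with $\alpha^\vee$ (so that $(v,\alpha^\vee)=2(v,\alpha)/(\alpha,\alpha)$ for any $W$-invariant scalar product on $E$). Let $\{\alpha_i\mid i\in I\}$ be a set of simple roots and $\Lambda=\{v\in E\mid (v,\alpha_i^\vee)\in\mathbb{Z}\text{ for all }i\in I\}$ the weight lattice. A non-zero weight $\lambda\in\Lambda$ is called minuscule if it is dominant, i.e. $(\lambda,\alpha_i^\vee)\ge 0$ for all $i\in I$, and $(\lambda,\alpha^\vee)\in\{0,\pm1\}$ for all $\alpha\in\Phi$. Let $\Psi\subseteq\Lambda$ be a non-empty union of $W$-orbits of minuscule weights, let $M$ be a $\mathbb{C}$-vector space with basis $\{z_\mu\mid\mu\in\Psi\}$, and define linear maps $e_i,f_i,h_i\colon M\to M$ ($i\in I$) by \[ e_i(z_\mu)=\begin{cases} z_{\mu+\alpha_i} & \text{if }(\mu,\alpha_i^\vee)=-1,\\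 0&\text{otherwise,}\end{cases}\qquad f_i(z_\mu)=\begin{cases} z_{\mu-\alpha_i} & \text{if }(\mu,\alpha_i^\vee)=1,\\ 0&\text{otherwise,}\end{cases}\qquad h_i(z_\mu)=(\mu,\alpha_i^\vee)z_\mu .\] Let $\mathfrak{g}\subseteq\mathfrak{gl}(M)$ be the Lie subalgebra generated by all $e_i,f_i$ ($i\in I$), and let $\mathfrak{h}=\langle h_i\mid i\in I\rangle_{\mathbb{C}}$, which is an abelian subalgebra of $\mathfrak{g}$ with basis $\{h_i\mid i\in I\}$. For $\mu\in E$ let $\dot\mu\in\mathfrak{h}^*$ be the linear form with $\dot\mu(h_j)=(\mu,\alpha_j^\vee)$ for all $j\in I$. For $\chi\in\mathfrak{h}^*$ let $\mathfrak{g}_\chi=\{x\in\mathfrak{g}\mid[h,x]=\chi(h)x\text{ for all }h\in\mathfrak{h}\}$, and write $\mathfrak{g}_\alpha=\mathfrak{g}_{\dot\alpha}$ for $\alpha\in\Phi$. Then $\mathfrak{g}$ is a simple Lie algebra, $\mathfrak{h}$ is a Cartan subalgebra of $\mathfrak{g}$, and the root system of $\mathfrak{g}$ with respect to $\mathfrak{h}$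 is $\dot\Phi=\{\dot\alpha\mid\alpha\in\Phi\}$, that is, $\{\chi\in\mathfrak{h}^*\mid \chi\ne0,\ \mathfrak{g}_\chi\neq0\}=\dot\Phi$. In particular, there is a direct sum decomposition $\mathfrak{g}=\mathfrak{h}\oplus\bigoplus_{\alpha\in\Phi}\mathfrak{g}_\alpha$, where $\dim\mathfrak{g}_\alpha=1$ for all $\alpha\in\Phi$. -/

import Mathlib

noncomputable section

open Module Set

-- The Lie ring structure of `gl(M)` is the commutator bracket `⁅x, y⁆ = x * y - y * x`.
attribute [local instance 100] LieRing.ofAssociativeRing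

namespace Minuscule

variable {ι E E' : Type*} [AddCommGroup E] [Module ℚ E] [AddCommGroup E'] [Module ℚ E']
variable {P : RootPairing ι ℚ E E'}

/-- The weight lattice `Λ`: the vectors of `E` whose pairings with all simple coroots are integers
(equivalently, the `ℤ`-span of the basis of `E` dual to the simple coroots). -/
def weightLattice (b : P.Base) : AddSubgroup E where
  carrier := {v | ∀ i ∈ b.support, ∃ n : ℤ, P.toLinearMap v (P.coroot i) = n}
  zero_mem' i _ := ⟨0, by simp⟩
  add_mem' {v w} hv hw i hi := by
    obtain ⟨m, hm⟩ := hv i hi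
    obtain ⟨n, hn⟩ := hw i hi
    exact ⟨m + n, by simp [hm, hn]⟩
  neg_mem' {v} hv i hi := by
    obtain ⟨m, hm⟩ := hv i hi
    exact ⟨-m, by simp [hm]⟩

/-- A minuscule (dominant) weight: a non-zero dominant weight whose pairing with every coroot is
`0`, `1` or `-1`. -/
structure IsMinuscule (b : P.Base) (v : E) : Prop where
  mem_weightLattice : v ∈ weightLattice b
  ne_zero : v ≠ 0
  dominant : ∀ i ∈ b.support, 0 ≤ P.toLinearMap v (P.coroot i)
  pairing : ∀ i : ι, P.toLinearMap v (P.coroot i) ∈ ({0, 1, -1} : Set ℚ)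

/-- `Ψ` is a non-empty union of Weyl group orbits of minuscule weights. -/
def IsMinusculeUnion (b : P.Base) (Ψ : Set E) : Prop :=
  ∃ S : Set E, S.Nonempty ∧ (∀ v ∈ S, IsMinuscule b v) ∧
    Ψ = ⋃ v ∈ S, MulAction.orbit P.weylGroup v

/-! ### Elementary facts which make the operators below well-defined -/

section facts

variable {b : P.Base} {Ψ : Set E}

lemma pairing_smul (w : P.weylGroup) (v : E)
    (hv : ∀ i : ι, P.toLinearMap v (P.coroot i) ∈ ({0, 1, -1} : Set ℚ)) (i : ι) :
    P.toLinearMap (w • v) (P.coroot i) ∈ ({0, 1, -1} : Set ℚ) := by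
  obtain ⟨g, hg⟩ := w
  induction hg using RootPairing.weylGroup.induction generalizing v i with
  | mem j =>
    have h : P.toLinearMap (P.reflection j v) (P.coroot i) =
        P.toLinearMap v (P.coroot (P.reflectionPerm j i)) := by
      rw [← P.reflectionPerm_coroot, RootPairing.reflection_apply]
      simp only [map_sub, map_smul, LinearMap.sub_apply, LinearMap.smul_apply, smul_eq_mul]
      simp [RootPairing.coroot', mul_comm]
    have h' : (⟨_, P.reflection_mem_weylGroup j⟩ : P.weylGroup) • v = P.reflection j v := by
      exact RootPairing.weylGroup.ofIdx_smul P j v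
    rw [h', h]
    exact hv _
  | one => simpa using! hv i
  | mul g₁ g₂ hg₁ hg₂ h₁ h₂ =>
    rw [← Submonoid.mk_mul_mk _ _ _ hg₁ hg₂, mul_smul]
    exact h₁ _ (fun j ↦ h₂ _ hv j) i

lemma IsMinusculeUnion.pairing_mem (hΨ : IsMinusculeUnion b Ψ) {v : E} (hv : v ∈ Ψ) (i : ι) :
    P.toLinearMap v (P.coroot i) ∈ ({0, 1, -1} : Set ℚ) := by
  obtain ⟨S, -, hS, rfl⟩ := hΨ
  obtain ⟨u, hu, w, rfl⟩ := mem_iUnion₂.1 hv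
  exact pairing_smul w u (hS u hu).pairing i

lemma IsMinusculeUnion.reflection_mem (hΨ : IsMinusculeUnion b Ψ) {v : E} (hv : v ∈ Ψ) (i : ι) :
    P.reflection i v ∈ Ψ := by
  obtain ⟨S, -, -, rfl⟩ := hΨ
  obtain ⟨u, hu, w, rfl⟩ := mem_iUnion₂.1 hv
  refine mem_iUnion₂.2 ⟨u, hu, RootPairing.weylGroup.ofIdx P i * w, ?_⟩
  exact mul_smul _ _ _

lemma IsMinusculeUnion.add_root_mem (hΨ : IsMinusculeUnion b Ψ) {v : E} (hv : v ∈ Ψ) {i : ι}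
    (h : P.toLinearMap v (P.coroot i) = -1) : v + P.root i ∈ Ψ := by
  have := hΨ.reflection_mem hv i
  rwa [RootPairing.reflection_apply, RootPairing.coroot', LinearMap.flip_apply, h, neg_one_smul,
    sub_neg_eq_add] at this

lemma IsMinusculeUnion.sub_root_mem (hΨ : IsMinusculeUnion b Ψ) {v : E} (hv : v ∈ Ψ) {i : ι}
    (h : P.toLinearMap v (P.coroot i) = 1) : v - P.root i ∈ Ψ := by
  have := hΨ.reflection_mem hv i
  rwa [RootPairing.reflection_apply, RootPairing.coroot', LinearMap.flip_apply, h, one_smul] at this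

lemma IsMinusculeUnion.span_eq_top [P.IsIrreducible] (hΨ : IsMinusculeUnion b Ψ) :
    Submodule.span ℚ Ψ = ⊤ := by
  refine RootPairing.IsIrreducible.eq_top_of_invtSubmodule_reflection (P := P) _ (fun i ↦ ?_) ?_
  · rw [Module.End.mem_invtSubmodule, Submodule.span_le]
    intro v hv
    exact Submodule.subset_span (hΨ.reflection_mem hv i)
  · obtain ⟨S, ⟨v, hv⟩, hS, rfl⟩ := hΨ
    rw [Submodule.ne_bot_iff]
    exact ⟨v, Submodule.subset_span (mem_iUnion₂.2 ⟨v, hv, MulAction.mem_orbit_self v⟩),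
      (hS v hv).ne_zero⟩

end facts

/-! ### Jantzen's operators on the space with basis `z_μ`, `μ ∈ Ψ` -/

variable {b : P.Base} {Ψ : Set E} {M : Type*} [AddCommGroup M] [Module ℂ M]

/-- `e_i z_μ = z_{μ + α_i}` if `(μ, α_i^∨) = -1`, and `e_i z_μ = 0` otherwise. -/
def opE (hΨ : IsMinusculeUnion b Ψ) (z : Basis Ψ ℂ M) (i : b.support) : End ℂ M :=
  z.constr ℂ fun μ ↦
    if h : P.toLinearMap μ (P.coroot i) = -1 then z ⟨μ + P.root i, hΨ.add_root_mem μ.2 h⟩ else 0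

/-- `f_i z_μ = z_{μ - α_i}` if `(μ, α_i^∨) = 1`, and `f_i z_μ = 0` otherwise. -/
def opF (hΨ : IsMinusculeUnion b Ψ) (z : Basis Ψ ℂ M) (i : b.support) : End ℂ M :=
  z.constr ℂ fun μ ↦
    if h : P.toLinearMap μ (P.coroot i) = 1 then z ⟨μ - P.root i, hΨ.sub_root_mem μ.2 h⟩ else 0

/-- `h_i z_μ = (μ, α_i^∨) z_μ`. -/
def opH (z : Basis Ψ ℂ M) (i : b.support) : End ℂ M :=
  z.constr ℂ fun μ ↦ (P.toLinearMap μ (P.coroot i) : ℂ) • z μ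

/-- The Lie subalgebra `𝔤` of `gl(M)` generated by all `e_i` and `f_i`. -/
def lieAlg (hΨ : IsMinusculeUnion b Ψ) (z : Basis Ψ ℂ M) : LieSubalgebra ℂ (End ℂ M) :=
  LieSubalgebra.lieSpan ℂ (End ℂ M) (range (opE hΨ z) ∪ range (opF hΨ z))

lemma lie_opE_opF (hΨ : IsMinusculeUnion b Ψ) (z : Basis Ψ ℂ M) (i : b.support) :
    ⁅opE hΨ z i, opF hΨ z i⁆ = opH z i := by
  refine z.ext fun μ ↦ ?_
  have h2 := P.root_coroot_two i
  rcases hΨ.pairing_mem μ.2 i with h | h | h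
  · simp [Ring.lie_def, opE, opF, opH, h]
  · simp [Ring.lie_def, opE, opF, opH, h, h2]
    norm_num
  · rw [mem_singleton_iff] at h
    simp [Ring.lie_def, opE, opF, opH, h, h2]
    norm_num

lemma opH_mem (hΨ : IsMinusculeUnion b Ψ) (z : Basis Ψ ℂ M) (i : b.support) :
    opH z i ∈ lieAlg hΨ z := by
  rw [← lie_opE_opF hΨ z i]
  exact LieSubalgebra.lie_mem _ (LieSubalgebra.subset_lieSpan (.inl ⟨i, rfl⟩))
    (LieSubalgebra.subset_lieSpan (.inr ⟨i, rfl⟩))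

/-- `h_i` as an element of `𝔤`. -/
def elH (hΨ : IsMinusculeUnion b Ψ) (z : Basis Ψ ℂ M) (i : b.support) : lieAlg hΨ z :=
  ⟨opH z i, opH_mem hΨ z i⟩

lemma lie_elH_elH (hΨ : IsMinusculeUnion b Ψ) (z : Basis Ψ ℂ M) (i j : b.support) :
    ⁅elH hΨ z i, elH hΨ z j⁆ = 0 := by
  refine Subtype.ext (z.ext fun μ ↦ ?_)
  simp [elH, Ring.lie_def, opH, smul_smul, mul_comm]

/-- `𝔥`, the linear span of the `h_i`, as a Lie subalgebra of `𝔤`. -/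
def cartan (hΨ : IsMinusculeUnion b Ψ) (z : Basis Ψ ℂ M) : LieSubalgebra ℂ (lieAlg hΨ z) where
  __ := Submodule.span ℂ (range (elH hΨ z))
  lie_mem' {x y} hx hy := by
    have : ⁅x, y⁆ = 0 := by
      induction hx, hy using Submodule.span_induction₂ with
      | mem_mem x y hx hy =>
        obtain ⟨i, rfl⟩ := hx
        obtain ⟨j, rfl⟩ := hy
        exact lie_elH_elH hΨ z i j
      | zero_left => simp
      | zero_right => simp
      | add_left x y w _ _ _ h₁ h₂ => simp [h₁, h₂]
      | add_right x y w _ _ _ h₁ h₂ => simp [h₁, h₂]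
      | smul_left r x y _ _ h => simp [h]
      | smul_right r x y _ _ h => simp [h]
    rw [this]
    exact Submodule.zero_mem _

lemma linearIndependent_elH [P.IsRootSystem] [P.IsIrreducible] (hΨ : IsMinusculeUnion b Ψ)
    (z : Basis Ψ ℂ M) : LinearIndependent ℂ (elH hΨ z) := by
  classical
  rw [Fintype.linearIndependent_iff]
  intro x hx
  -- the functional `v ↦ ∑ x_j (v, α_j^∨)` on `E` vanishes on `Ψ`, hence on `E`
  let φ : E →ₗ[ℚ] ℂ :=
    ∑ j : b.support, ((LinearMap.toSpanSingleton ℚ ℂ (x j)) ∘ₗ P.toLinearMap.flip (P.coroot j))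
  have hφ (v : E) : φ v = ∑ j : b.support, (P.toLinearMap v (P.coroot j) : ℂ) * x j := by
    simp [φ, Rat.smul_def]
  have h0 : φ = 0 := by
    refine LinearMap.ext_on hΨ.span_eq_top fun v hv ↦ ?_
    have h1 : (∑ j, x j • opH z j : End ℂ M) (z ⟨v, hv⟩) = 0 := by
      have h2 := congrArg (lieAlg hΨ z).toSubmodule.subtype hx
      rw [map_sum, map_zero] at h2
      exact LinearMap.congr_fun h2 _
    simp only [opH, LinearMap.sum_apply, LinearMap.smul_apply, Basis.constr_basis, smul_smul,
      ← Finset.sum_smul, smul_eq_zero, z.ne_zero, or_false] at h1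
    rw [hφ, LinearMap.zero_apply, ← h1]
    exact Finset.sum_congr rfl fun j _ ↦ mul_comm _ _
  intro i
  let d : Dual ℚ E' := b.toCoweightBasis.coord i
  have h2 := hφ (P.toPerfPair.symm d)
  have h3 (j : b.support) : P.toLinearMap (P.toPerfPair.symm d) (P.coroot j) =
      if j = i then 1 else 0 := by
    have : P.toLinearMap (P.toPerfPair.symm d) = d := P.toPerfPair.apply_symm_apply d
    rw [this, ← b.toCoweightBasis_apply j]
    simp [d, Finsupp.single_apply]
  rw [h0, LinearMap.zero_apply, Finset.sum_eq_single i
      (fun j _ hj ↦ by rw [h3, if_neg hj, Rat.cast_zero, zero_mul]) (by simp),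
    h3, if_pos rfl, Rat.cast_one, one_mul] at h2
  exact h2.symm

/-- The `h_i` form a basis of `𝔥`. -/
def basisH [P.IsRootSystem] [P.IsIrreducible] (hΨ : IsMinusculeUnion b Ψ) (z : Basis Ψ ℂ M) :
    Basis b.support ℂ (cartan hΨ z) :=
  Basis.span (linearIndependent_elH hΨ z)

lemma coe_basisH [P.IsRootSystem] [P.IsIrreducible] (hΨ : IsMinusculeUnion b Ψ) (z : Basis Ψ ℂ M)
    (i : b.support) : (basisH hΨ z i : lieAlg hΨ z) = elH hΨ z i :=
  congrArg Subtype.val (Basis.span_apply (linearIndependent_elH hΨ z) i)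

/-- For `μ ∈ E`, the linear form `μ̇` on `𝔥` with `μ̇(h_j) = (μ, α_j^∨)` for all `j`. -/
def dot [P.IsRootSystem] [P.IsIrreducible] (hΨ : IsMinusculeUnion b Ψ) (z : Basis Ψ ℂ M) (μ : E) :
    Dual ℂ (cartan hΨ z) :=
  (basisH hΨ z).constr ℂ fun j ↦ (P.toLinearMap μ (P.coroot j) : ℂ)

/-- `𝔤_χ = {x ∈ 𝔤 | ⁅h, x⁆ = χ(h) x for all h ∈ 𝔥}`. -/
def rootSpace (hΨ : IsMinusculeUnion b Ψ) (z : Basis Ψ ℂ M) (χ : Dual ℂ (cartan hΨ z)) :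
    Submodule ℂ (lieAlg hΨ z) :=
  (LieModule.weightSpace (lieAlg hΨ z) χ).toSubmodule

lemma mem_rootSpace (hΨ : IsMinusculeUnion b Ψ) (z : Basis Ψ ℂ M) (χ : Dual ℂ (cartan hΨ z))
    (x : lieAlg hΨ z) :
    x ∈ rootSpace hΨ z χ ↔ ∀ h : cartan hΨ z, ⁅(h : lieAlg hΨ z), x⁆ = χ h • x :=
  LieModule.mem_weightSpace _ x

/-- The family of subspaces `𝔥` (at `none`) and `𝔤_α`, `α ∈ Φ` (at `some`). -/
def rootDecomposition [P.IsRootSystem] [P.IsIrreducible] (hΨ : IsMinusculeUnion b Ψ)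
    (z : Basis Ψ ℂ M) : Option ι → Submodule ℂ (lieAlg hΨ z)
  | none => (cartan hΨ z).toSubmodule
  | some i => rootSpace hΨ z (dot hΨ z (P.root i))

end Minuscule

end

noncomputable section

open Module Set

attribute [local instance 100] LieRing.ofAssociativeRing

namespace Minuscule

variable {ι E E' M : Type*} [AddCommGroup E] [Module ℚ E] [AddCommGroup E'] [Module ℚ E']
  {P : RootPairing ι ℚ E E'} {b : P.Base} {Ψ : Set E} [AddCommGroup M] [Module ℂ M]

/-! Since the weights in Ψ pair with every coroot to 0 or ±1, the operators satisfy [e_i, f_j] =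
δ_ij h_i, and ad h_j acts on e_i and f_i through the Cartan matrix of Φ. This is packaged in
`lieBasis`; the general theory of such generating systems makes 𝔥 a self-centralising Cartan
subalgebra.

Simplicity rests on positivity rather than on root theory. For the Hermitian form with orthonormal
basis z, e_i and f_i are adjoint to each other, so 𝔤 is closed under x ↦ x*. A nonzero ideal
contains a common eigenvector x of ad 𝔥, of some weight χ. If χ ≠ 0, then [x, x*] lies in 𝔥 and is
nonzero, because tr(h[x, x*]) = χ(h) tr(x x*). So the ideal meets 𝔥 (`exists_mem_cartan_ne_zero`);
it then contains some e_i and, the Dynkin diagram being connected, all generators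
(`eq_top_of_lieIdeal_ne_bot`).

Being simple, 𝔤 has a nondegenerate Killing form and hence a root system. The map α ↦ α̇ matches
simple roots (`baseSupp_lieBasis`) and intertwines simple reflections (`reflection_rootSystem_dot`).
Both systems arise from their simple roots by negation and simple reflections, so they correspond.
-/

lemma eq_zero_of_forall_pairing_eq_zero [P.IsRootSystem] (b : P.Base) {v : E}
    (h : ∀ i ∈ b.support, P.toLinearMap v (P.coroot i) = 0) : v = 0 := by
  have h1 : P.toLinearMap v = 0 := b.toCoweightBasis.ext fun i ↦ by simpa using h i i.2
  exact P.toPerfPair.injective (by simpa using h1)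

/-- A vector is determined by its pairings with the finitely many coroots, and on Ψ each pairing
takes only three values. -/
lemma IsMinusculeUnion.finite [P.IsRootSystem] [Finite ι] (hΨ : IsMinusculeUnion b Ψ) :
    Ψ.Finite := by
  let g : E → ι → ℚ := fun v i ↦ P.toLinearMap v (P.coroot i)
  have hg : Function.Injective g := fun v w h ↦ by
    refine sub_eq_zero.1 (eq_zero_of_forall_pairing_eq_zero b fun i _ ↦ ?_)
    have := congrFun h i
    simpa [g, sub_eq_zero] using this
  refine ((Set.Finite.pi' (t := fun _ : ι ↦ ({0, 1, -1} : Set ℚ)) fun _ ↦ Set.toFinite _).preimage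
    hg.injOn).subset fun v hv i ↦ hΨ.pairing_mem hv i

/-! ### Chevalley relations for the operators -/

section relations

variable (hΨ : IsMinusculeUnion b Ψ) (z : Basis Ψ ℂ M)

lemma opE_apply (i : b.support) {v : E} (hv : v ∈ Ψ) (h : P.toLinearMap v (P.coroot i) = -1) :
    opE hΨ z i (z ⟨v, hv⟩) = z ⟨v + P.root i, hΨ.add_root_mem hv h⟩ := by
  simp [opE, h]

lemma opE_apply_of_ne (i : b.support) {v : E} (hv : v ∈ Ψ)
    (h : P.toLinearMap v (P.coroot i) ≠ -1) : opE hΨ z i (z ⟨v, hv⟩) = 0 := by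
  simp [opE, h]

lemma opF_apply (i : b.support) {v : E} (hv : v ∈ Ψ) (h : P.toLinearMap v (P.coroot i) = 1) :
    opF hΨ z i (z ⟨v, hv⟩) = z ⟨v - P.root i, hΨ.sub_root_mem hv h⟩ := by
  simp [opF, h]

lemma opF_apply_of_ne (i : b.support) {v : E} (hv : v ∈ Ψ)
    (h : P.toLinearMap v (P.coroot i) ≠ 1) : opF hΨ z i (z ⟨v, hv⟩) = 0 := by
  simp [opF, h]

lemma opH_apply (i : b.support) {v : E} (hv : v ∈ Ψ) :
    opH z i (z ⟨v, hv⟩) = (P.toLinearMap v (P.coroot i) : ℂ) • z ⟨v, hv⟩ := by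
  simp [opH]

lemma lie_opH_opE (i j : b.support) :
    ⁅opH z j, opE hΨ z i⁆ = (P.pairing i j : ℂ) • opE hΨ z i := by
  refine z.ext fun ⟨v, hv⟩ ↦ ?_
  simp only [Ring.lie_def, LinearMap.sub_apply, Module.End.mul_apply, LinearMap.smul_apply]
  rw [opH_apply]
  by_cases h : P.toLinearMap v (P.coroot i) = -1
  · rw [map_smul, opE_apply hΨ z i hv h, opH_apply]
    simp only [map_add, LinearMap.add_apply, Rat.cast_add, add_smul, add_sub_cancel_left,
      P.root_coroot_eq_pairing]
  · simp [opE_apply_of_ne hΨ z i hv h]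

lemma lie_opH_opF (i j : b.support) :
    ⁅opH z j, opF hΨ z i⁆ = -(P.pairing i j : ℂ) • opF hΨ z i := by
  refine z.ext fun ⟨v, hv⟩ ↦ ?_
  simp only [Ring.lie_def, LinearMap.sub_apply, Module.End.mul_apply, LinearMap.smul_apply]
  rw [opH_apply]
  by_cases h : P.toLinearMap v (P.coroot i) = 1
  · rw [map_smul, opF_apply hΨ z i hv h, opH_apply]
    simp only [map_sub, LinearMap.sub_apply, Rat.cast_sub, sub_smul, sub_sub_cancel_left,
      P.root_coroot_eq_pairing, neg_smul]
  · simp [opF_apply_of_ne hΨ z i hv h]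

/-- If only one of e_i, f_j acts nontrivially on z_μ, then (α_i, α_j^∨) ≤ 0 and its transpose keep
the other from becoming nonzero afterwards. If both act, orthogonal roots give z_{μ+α_i-α_j} in
either order, while for non-orthogonal roots the first operator moves the pairing needed by the
second, so both composites vanish. -/
lemma lie_opE_opF_of_ne [Finite ι] [P.IsCrystallographic] {i j : b.support} (hij : i ≠ j) :
    ⁅opE hΨ z i, opF hΨ z j⁆ = 0 := by
  have hle (k l : b.support) (hkl : k ≠ l) : P.pairing k l ≤ 0 := by
    have h := b.cartanMatrix_le_zero_of_ne k l hkl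
    rw [RootPairing.Base.cartanMatrix, RootPairing.Base.cartanMatrixIn_def] at h
    rw [← P.algebraMap_pairingIn ℤ]
    simpa using h
  have h1 := hle i j hij
  have h2 := hle j i hij.symm
  have h3 : P.pairing i j = 0 ↔ P.pairing j i = 0 := P.pairing_eq_zero_iff
  refine z.ext fun ⟨v, hv⟩ ↦ ?_
  simp only [Ring.lie_def, LinearMap.sub_apply, Module.End.mul_apply, LinearMap.zero_apply]
  have ha := hΨ.pairing_mem hv i
  have hc := hΨ.pairing_mem hv j
  have ha' (h : P.toLinearMap v (P.coroot j) = 1) := hΨ.pairing_mem (hΨ.sub_root_mem hv h) i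
  have hc' (h : P.toLinearMap v (P.coroot i) = -1) := hΨ.pairing_mem (hΨ.add_root_mem hv h) j
  simp only [map_add, map_sub, LinearMap.add_apply, LinearMap.sub_apply,
    P.root_coroot_eq_pairing, mem_insert_iff, mem_singleton_iff] at ha hc ha' hc'
  by_cases hi : P.toLinearMap v (P.coroot i) = -1 <;>
    by_cases hj : P.toLinearMap v (P.coroot j) = 1
  · rw [opE_apply hΨ z i hv hi, opF_apply hΨ z j hv hj]
    by_cases hij0 : P.pairing i j = 0
    · have hji0 := h3.1 hij0
      rw [opE_apply hΨ z i, opF_apply hΨ z j, sub_eq_zero]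
      · congr 2
        abel
      · simp [hj, hij0, P.root_coroot_eq_pairing]
      · simp [hi, hji0, P.root_coroot_eq_pairing]
    · have hji0 := mt h3.2 hij0
      rw [opE_apply_of_ne hΨ z i, opF_apply_of_ne hΨ z j, sub_zero]
      · simp [hj, hij0, P.root_coroot_eq_pairing]
      · simp [hi, hji0, P.root_coroot_eq_pairing]
  · rw [opE_apply hΨ z i hv hi, opF_apply_of_ne hΨ z j hv hj, opF_apply_of_ne hΨ z j]
    · simp
    · simp only [map_add, LinearMap.add_apply, P.root_coroot_eq_pairing]
      intro h
      rcases hc with h' | h' | h'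
      · linarith
      · exact hj h'
      · linarith
  · rw [opE_apply_of_ne hΨ z i hv hi, opF_apply hΨ z j hv hj, opE_apply_of_ne hΨ z i]
    · simp
    · simp only [map_sub, LinearMap.sub_apply, P.root_coroot_eq_pairing]
      intro h
      rcases ha with h' | h' | h'
      · linarith
      · linarith
      · exact hi h'
  · rw [opE_apply_of_ne hΨ z i hv hi, opF_apply_of_ne hΨ z j hv hj]
    simp

/-- `e_i` as an element of `𝔤`. -/
def elE (i : b.support) : lieAlg hΨ z :=
  ⟨opE hΨ z i, LieSubalgebra.subset_lieSpan (.inl ⟨i, rfl⟩)⟩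

/-- `f_i` as an element of `𝔤`. -/
def elF (i : b.support) : lieAlg hΨ z :=
  ⟨opF hΨ z i, LieSubalgebra.subset_lieSpan (.inr ⟨i, rfl⟩)⟩

lemma lieSpan_elE_elF :
    LieSubalgebra.lieSpan ℂ (lieAlg hΨ z) (range (elE hΨ z) ∪ range (elF hΨ z)) = ⊤ := by
  refine top_le_iff.1 (Eq.trans_le (LieSubalgebra.lieSpan_lieSpan_coe_preimage
    (s := range (opE hΨ z) ∪ range (opF hΨ z))).symm (LieSubalgebra.lieSpan_mono ?_))
  rintro ⟨x, hx⟩ (⟨i, hi⟩ | ⟨i, hi⟩)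
  · exact .inl ⟨i, Subtype.ext hi⟩
  · exact .inr ⟨i, Subtype.ext hi⟩

lemma cartan_eq_lieSpan :
    cartan hΨ z = LieSubalgebra.lieSpan ℂ (lieAlg hΨ z) (range (elH hΨ z)) := by
  rw [← LieSubalgebra.toSubmodule_inj, LieSubalgebra.coe_lieSpan_eq_span_of_forall_lie_eq_zero]
  · rfl
  · rintro - ⟨i, rfl⟩ - ⟨j, rfl⟩
    exact lie_elH_elH hΨ z i j

/-- The operators `e_i`, `f_i`, `h_i` satisfy the Chevalley–Serre relations. -/
def lieBasis [Finite ι] [P.IsRootSystem] [P.IsCrystallographic] [P.IsIrreducible] :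
    LieAlgebra.Basis b.support (cartan hΨ z) where
  A := b.cartanMatrix
  h := elH hΨ z
  e := elE hΨ z
  f := elF hΨ z
  cartan_eq_lieSpan := cartan_eq_lieSpan hΨ z
  span_ef := lieSpan_elE_elF hΨ z
  linInd := linearIndependent_elH hΨ z
  nondegen := b.cartanMatrix_nondegenerate
  sl2 i :=
    { h_ne_zero := (linearIndependent_elH hΨ z).ne_zero i
      lie_e_f := Subtype.ext (lie_opE_opF hΨ z i)
      lie_h_e_nsmul := Subtype.ext <| (lie_opH_opE hΨ z i i).trans <| by
        simp [elE, ofNat_smul_eq_nsmul]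
      lie_h_f_nsmul := Subtype.ext <| (lie_opH_opF hΨ z i i).trans <| by
        simp [elF, ofNat_smul_eq_nsmul] }
  lie_h_h := lie_elH_elH hΨ z
  lie_h_e i j := Subtype.ext <| (lie_opH_opE hΨ z i j).trans <| by
    rw [← P.algebraMap_pairingIn ℤ, ← Int.cast_smul_eq_zsmul ℂ]
    simp [elE, RootPairing.Base.cartanMatrix, RootPairing.Base.cartanMatrixIn_def]
  lie_h_f i j := Subtype.ext <| (lie_opH_opF hΨ z i j).trans <| by
    rw [← P.algebraMap_pairingIn ℤ, neg_smul, neg_smul, ← Int.cast_smul_eq_zsmul ℂ]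
    simp [elF, RootPairing.Base.cartanMatrix, RootPairing.Base.cartanMatrixIn_def]
  lie_e_f_ne i j hij := Subtype.ext (lie_opE_opF_of_ne hΨ z hij)

end relations

end Minuscule

namespace Minuscule

/-! ### Adjoints and positivity of the trace form -/

section adjoint

variable {κ M : Type*} [Fintype κ] [DecidableEq κ] [AddCommGroup M] [Module ℂ M]
  (z : Basis κ ℂ M)

/-- The adjoint of an endomorphism for the Hermitian form with orthonormal basis `z`. -/
def adj (x : End ℂ M) : End ℂ M :=
  (LinearMap.toMatrixAlgEquiv z).symm (LinearMap.toMatrixAlgEquiv z x).conjTranspose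

lemma toMatrixAlgEquiv_adj (x : End ℂ M) :
    LinearMap.toMatrixAlgEquiv z (adj z x) = (LinearMap.toMatrixAlgEquiv z x).conjTranspose :=
  AlgEquiv.apply_symm_apply _ _

lemma adj_adj (x : End ℂ M) : adj z (adj z x) = x := by
  simp [adj]

@[simp] lemma adj_zero : adj z 0 = 0 := by simp [adj]

lemma adj_add (x y : End ℂ M) : adj z (x + y) = adj z x + adj z y := by
  simp [adj]

lemma adj_sub (x y : End ℂ M) : adj z (x - y) = adj z x - adj z y := by
  simp [adj]

lemma adj_smul (c : ℂ) (x : End ℂ M) : adj z (c • x) = star c • adj z x := by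
  simp [adj]

lemma adj_mul (x y : End ℂ M) : adj z (x * y) = adj z y * adj z x := by
  simp [adj]

lemma adj_lie (x y : End ℂ M) : adj z ⁅x, y⁆ = ⁅adj z y, adj z x⁆ := by
  simp [Ring.lie_def, adj_sub, adj_mul]

lemma trace_eq_trace_toMatrixAlgEquiv (x : End ℂ M) :
    LinearMap.trace ℂ M x = (LinearMap.toMatrixAlgEquiv z x).trace :=
  LinearMap.trace_eq_matrix_trace ℂ z x

lemma trace_adj (x : End ℂ M) :
    LinearMap.trace ℂ M (adj z x) = star (LinearMap.trace ℂ M x) := by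
  rw [trace_eq_trace_toMatrixAlgEquiv z, trace_eq_trace_toMatrixAlgEquiv z, toMatrixAlgEquiv_adj,
    Matrix.trace_conjTranspose]

-- The trace is the sum of the squared absolute values of the matrix entries of x.
open scoped ComplexOrder in
lemma trace_mul_adj_ne_zero {x : End ℂ M} (hx : x ≠ 0) :
    LinearMap.trace ℂ M (x * adj z x) ≠ 0 := by
  rw [trace_eq_trace_toMatrixAlgEquiv z, map_mul, toMatrixAlgEquiv_adj, ne_eq,
    Matrix.trace_mul_conjTranspose_self_eq_zero_iff]
  simpa using hx

variable {z} {h x : End ℂ M} {c : ℂ}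

lemma trace_mul_lie_adj (hx : ⁅h, x⁆ = c • x) :
    LinearMap.trace ℂ M (h * ⁅x, adj z x⁆) = c * LinearMap.trace ℂ M (x * adj z x) := by
  -- The correction term is a commutator, so it has trace zero.
  have h1 : h * ⁅x, adj z x⁆ = ⁅h, x⁆ * adj z x + (x * (h * adj z x) - (h * adj z x) * x) := by
    simp only [Ring.lie_def]
    noncomm_ring
  rw [h1, hx, map_add, map_sub, LinearMap.trace_mul_comm ℂ x (h * adj z x), sub_self, add_zero,
    smul_mul_assoc, map_smul, smul_eq_mul]

/-- Both traces in `trace_mul_lie_adj` are real when h is self-adjoint, and tr(x x*) ≠ 0. -/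
lemma star_eq_of_lie_eq_smul (hh : adj z h = h) (hx : ⁅h, x⁆ = c • x) (hx0 : x ≠ 0) :
    star c = c := by
  have h1 := trace_mul_lie_adj (z := z) hx
  have h2 : star (LinearMap.trace ℂ M (x * adj z x)) = LinearMap.trace ℂ M (x * adj z x) := by
    rw [← trace_adj z, adj_mul, adj_adj]
  have h3 := congrArg star h1
  rw [← trace_adj z, adj_mul, adj_lie, adj_adj, hh, LinearMap.trace_mul_comm, h1, star_mul, h2,
    mul_comm] at h3
  exact (mul_left_cancel₀ (trace_mul_adj_ne_zero z hx0) h3).symm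

/-- As c is real, x* has weight -c, which cancels the weight c of x. -/
lemma lie_lie_adj_eq_zero (hh : adj z h = h) (hx : ⁅h, x⁆ = c • x) :
    ⁅h, ⁅x, adj z x⁆⁆ = 0 := by
  by_cases hx0 : x = 0
  · simp [hx0]
  have h1 := congrArg (adj z) hx
  rw [adj_lie, hh, adj_smul, star_eq_of_lie_eq_smul hh hx hx0, ← lie_skew] at h1
  have h2 : ⁅h, adj z x⁆ = -(c • adj z x) := by rw [← h1, neg_neg]
  rw [leibniz_lie, hx, h2]
  simp

end adjoint

variable {ι E E' M : Type*} [AddCommGroup E] [Module ℚ E] [AddCommGroup E'] [Module ℚ E']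
  {P : RootPairing ι ℚ E E'} {b : P.Base} {Ψ : Set E} [AddCommGroup M] [Module ℂ M]

lemma IsMinusculeUnion.finiteDimensional [Finite ι] [P.IsRootSystem] (hΨ : IsMinusculeUnion b Ψ)
    (z : Basis Ψ ℂ M) : FiniteDimensional ℂ M :=
  have := hΨ.finite.to_subtype
  Module.Finite.of_basis z

lemma nonempty_support [P.IsRootSystem] [P.IsIrreducible] (b : P.Base) : Nonempty b.support := by
  have := RootPairing.IsIrreducible.nontrivial (P := P)
  obtain ⟨v, hv⟩ := exists_ne (0 : E)
  by_contra h
  exact hv (eq_zero_of_forall_pairing_eq_zero b fun i hi ↦ (h ⟨i, hi⟩).elim)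

variable (hΨ : IsMinusculeUnion b Ψ) (z : Basis Ψ ℂ M)

section adjoint

variable [Fintype Ψ] [DecidableEq Ψ]

/-- Both matrices have entries 0 and 1, and e_i sends z_μ to z_ν exactly when f_i sends z_ν to z_μ.
-/
lemma adj_opE (i : b.support) : adj z (opE hΨ z i) = opF hΨ z i := by
  refine (LinearMap.toMatrixAlgEquiv z).injective ?_
  rw [toMatrixAlgEquiv_adj]
  ext ⟨v, hv⟩ ⟨w, hw⟩
  rw [Matrix.conjTranspose_apply, LinearMap.toMatrixAlgEquiv_apply,
    LinearMap.toMatrixAlgEquiv_apply]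
  have h2 := P.root_coroot_two i
  by_cases h : P.toLinearMap v (P.coroot i) = -1
  · rw [opE_apply hΨ z i hv h]
    by_cases hvw : v + P.root i = w
    · have hw1 : P.toLinearMap w (P.coroot i) = 1 := by
        simp [← hvw, h, h2]; norm_num
      have hwv : w - P.root i = v := by simp [← hvw]
      rw [opF_apply hΨ z i hw hw1]
      simp [hvw, hwv]
    · by_cases hw1 : P.toLinearMap w (P.coroot i) = 1
      · have hwv : ¬ w - P.root i = v := fun h ↦ hvw (by simp [← h])
        rw [opF_apply hΨ z i hw hw1]
        simp [hvw, hwv]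
      · rw [opF_apply_of_ne hΨ z i hw hw1]
        simp [hvw]
  · rw [opE_apply_of_ne hΨ z i hv h]
    by_cases hw1 : P.toLinearMap w (P.coroot i) = 1
    · have hwv : ¬ w - P.root i = v := by
        rintro rfl
        simp [hw1, h2] at h
        norm_num at h
      rw [opF_apply hΨ z i hw hw1]
      simp [hwv]
    · rw [opF_apply_of_ne hΨ z i hw hw1]
      simp

lemma adj_opF (i : b.support) : adj z (opF hΨ z i) = opE hΨ z i := by
  rw [← adj_opE, adj_adj]

lemma adj_opH (hΨ : IsMinusculeUnion b Ψ) (z : Basis Ψ ℂ M) (i : b.support) :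
    adj z (opH z i) = opH z i := by
  rw [← lie_opE_opF hΨ z i, adj_lie, adj_opE, adj_opF]

lemma adj_mem {x : End ℂ M} (hx : x ∈ lieAlg hΨ z) : adj z x ∈ lieAlg hΨ z := by
  induction hx using LieSubalgebra.lieSpan_induction with
  | mem u hu =>
    obtain (⟨i, rfl⟩ | ⟨i, rfl⟩) := hu
    · rw [adj_opE]
      exact (elF hΨ z i).2
    · rw [adj_opF]
      exact (elE hΨ z i).2
  | zero => simp
  | add u v _ _ hu hv => rw [adj_add]; exact add_mem hu hv
  | smul t u _ hu => rw [adj_smul]; exact SMulMemClass.smul_mem _ hu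
  | lie u v _ _ hu hv => rw [adj_lie]; exact LieSubalgebra.lie_mem _ hv hu

end adjoint

/-! ### Ideals of 𝔤 and simplicity -/

variable [Finite ι] [P.IsRootSystem] [P.IsCrystallographic] [P.IsIrreducible]

lemma isLieAbelian_cartan : IsLieAbelian (cartan hΨ z) :=
  (lieBasis hΨ z).isLieAbelian_cartan

lemma mem_cartan_of_forall_lie_eq_zero {x : lieAlg hΨ z} (h : ∀ i, ⁅elH hΨ z i, x⁆ = 0) :
    x ∈ cartan hΨ z := by
  have := isLieAbelian_cartan hΨ z
  have h1 : x ∈ LieAlgebra.rootSpace (cartan hΨ z) 0 := by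
    rw [LieModule.mem_genWeightSpace]
    rintro ⟨y, hy⟩
    refine ⟨1, ?_⟩
    have : ⁅y, x⁆ = 0 := by
      induction hy using Submodule.span_induction with
      | mem u hu => obtain ⟨i, rfl⟩ := hu; exact h i
      | zero => simp
      | add u v _ _ hu hv => rw [add_lie, hu, hv, add_zero]
      | smul t u _ hu => rw [smul_lie, hu, smul_zero]
    simpa
  rwa [← (lieBasis hΨ z).cartan_eq] at h1

/-- The simple roots of `lieBasis` are linearly independent and as many as dim 𝔥, so they span the
dual of 𝔥 and separate its points. -/
lemma exists_baseSupp_ne_zero {w : cartan hΨ z} (hw : w ≠ 0) :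
    ∃ i, (lieBasis hΨ z).baseSupp i w ≠ 0 := by
  have := hΨ.finiteDimensional z
  contrapose! hw
  have hs : Submodule.span ℂ (range (lieBasis hΨ z).baseSupp) = ⊤ := by
    refine (lieBasis hΨ z).linearIndependent_baseSupp.span_eq_top_of_card_eq_finrank' ?_
    rw [Subspace.dual_finrank_eq, finrank_eq_card_basis (basisH hΨ z)]
  have h1 : Dual.eval ℂ (cartan hΨ z) w = 0 := by
    refine LinearMap.ext_on_range hs fun i ↦ ?_
    simpa using hw i
  exact (Module.eval_apply_eq_zero_iff ℂ w).1 h1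

lemma exists_mem_cartan_ne_zero {I : LieIdeal ℂ (lieAlg hΨ z)} (hI : I ≠ ⊥) :
    ∃ w ∈ I, w ≠ 0 ∧ w ∈ cartan hΨ z := by
  classical
  have := isLieAbelian_cartan hΨ z
  have := hΨ.finiteDimensional z
  have := hΨ.finite.fintype
  have : Nontrivial (I.restr (cartan hΨ z)) :=
    (LieSubmodule.nontrivial_iff_ne_bot ℂ (lieAlg hΨ z) (N := I)).2 hI
  -- The abelian algebra 𝔥 acts on the finite-dimensional space I over ℂ, so it has a common
  -- eigenvector there.
  obtain ⟨χ, hχ⟩ := LieModule.exists_nontrivial_weightSpace_of_isNilpotent ℂ (cartan hΨ z)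
    (I.restr (cartan hΨ z))
  obtain ⟨⟨⟨x, hxI⟩, hxχ⟩, hx0⟩ := exists_ne (0 : LieModule.weightSpace (I.restr (cartan hΨ z)) χ)
  rw [LieModule.mem_weightSpace] at hxχ
  have hxI : x ∈ I := hxI
  have hx0 : x ≠ 0 := fun h ↦ hx0 (by simpa using h)
  let c : b.support → ℂ := fun i ↦ χ ((lieBasis hΨ z).h' i)
  have hx (i : b.support) : ⁅elH hΨ z i, x⁆ = c i • x :=
    congrArg Subtype.val (hxχ ((lieBasis hΨ z).h' i))
  by_cases hc : c = 0
  · exact ⟨x, hxI, hx0, mem_cartan_of_forall_lie_eq_zero hΨ z fun i ↦ by simp [hx, hc]⟩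
  obtain ⟨i, hi⟩ := Function.ne_iff.1 hc
  let y : lieAlg hΨ z := ⟨adj z x, adj_mem hΨ z x.2⟩
  have hx' (i : b.support) : ⁅opH z i, (x : End ℂ M)⁆ = c i • (x : End ℂ M) :=
    congrArg Subtype.val (hx i)
  refine ⟨⁅x, y⁆, lie_mem_left ℂ _ I x y hxI, fun h ↦ ?_, ?_⟩
  · have h1 := trace_mul_lie_adj (z := z) (hx' i)
    have h2 : ⁅(x : End ℂ M), adj z x⁆ = 0 := congrArg Subtype.val h
    rw [h2, mul_zero, map_zero, eq_comm, mul_eq_zero] at h1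
    exact h1.elim hi (trace_mul_adj_ne_zero z (by simpa using hx0))
  · exact mem_cartan_of_forall_lie_eq_zero hΨ z fun i ↦
      Subtype.ext (lie_lie_adj_eq_zero (adj_opH hΨ z i) (hx' i))

variable [P.IsReduced]

lemma eq_top_of_lieIdeal_ne_bot {I : LieIdeal ℂ (lieAlg hΨ z)} (hI : I ≠ ⊥) : I = ⊤ := by
  let B := lieBasis hΨ z
  obtain ⟨w, hwI, hw0, hwc⟩ := exists_mem_cartan_ne_zero hΨ z hI
  obtain ⟨i, hi⟩ := exists_baseSupp_ne_zero hΨ z (w := ⟨w, hwc⟩)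
    (fun h ↦ hw0 (congrArg Subtype.val h))
  have hsmul {c : ℂ} {x : lieAlg hΨ z} (hc : c ≠ 0) (hx : c • x ∈ I) : x ∈ I :=
    (I.toSubmodule.smul_mem_iff hc).1 hx
  have hzsmul {c : ℤ} {x : lieAlg hΨ z} (hc : c ≠ 0) (hx : c • x ∈ I) : x ∈ I := by
    rw [← Int.cast_smul_eq_zsmul ℂ] at hx
    exact hsmul (Int.cast_ne_zero.2 hc) hx
  have hiI : B.e i ∈ I := by
    refine hsmul hi ?_
    rw [LieAlgebra.Basis.baseSupp_apply_smul_e]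
    exact lie_mem_left ℂ _ I _ _ hwI
  have hh (j : b.support) (hj : B.e j ∈ I) : B.h j ∈ I := by
    rw [← (B.sl2 j).lie_e_f]
    exact lie_mem_left ℂ _ I _ _ hj
  have he (j : b.support) : B.e j ∈ I := by
    -- Membership spreads along the edges of the connected Dynkin diagram: h_k ∈ I gives [h_k, e_l]
    -- ∈ I, a nonzero multiple of e_l when k and l are joined.
    refine b.induction_on_cartanMatrix (fun j ↦ B.e j ∈ I) hiI fun k l hk hlk ↦ ?_
    refine hzsmul hlk ?_
    change B.A l k • B.e l ∈ I
    rw [← B.lie_h_e]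
    exact lie_mem_left ℂ _ I _ _ (hh k hk)
  have hf (j : b.support) : B.f j ∈ I := by
    have h1 : -B.A j j ≠ 0 := by
      have : B.A j j = 2 := b.cartanMatrix_apply_same j
      simp [this]
    refine hzsmul h1 ?_
    rw [← B.lie_h_f]
    exact lie_mem_left ℂ _ I _ _ (hh j (he j))
  have h2 : LieSubalgebra.lieSpan ℂ (lieAlg hΨ z) (range B.e ∪ range B.f) ≤
      LieIdeal.toLieSubalgebra ℂ (lieAlg hΨ z) I := by
    rw [LieSubalgebra.lieSpan_le]
    rintro - (⟨j, rfl⟩ | ⟨j, rfl⟩)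
    · exact he j
    · exact hf j
  rw [B.span_ef] at h2
  exact top_le_iff.1 fun x _ ↦ h2 (LieSubalgebra.mem_top x)

theorem isSimple_lieAlg : LieAlgebra.IsSimple ℂ (lieAlg hΨ z) where
  eq_bot_or_eq_top _ := or_iff_not_imp_left.2 (eq_top_of_lieIdeal_ne_bot hΨ z)
  non_abelian h := by
    obtain ⟨i⟩ := nonempty_support b
    have h1 := ((lieBasis hΨ z).sl2 i)
    exact h1.h_ne_zero (h1.lie_e_f ▸ trivial_lie_zero _ _ _ _)

end Minuscule

namespace Minuscule

variable {ι E E' M : Type*} [AddCommGroup E] [Module ℚ E] [AddCommGroup E'] [Module ℚ E']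
  {P : RootPairing ι ℚ E E'} {b : P.Base} {Ψ : Set E}
  [AddCommGroup M] [Module ℂ M] (hΨ : IsMinusculeUnion b Ψ) (z : Basis Ψ ℂ M)

/-! ### Weight spaces and the map μ ↦ μ̇ -/

section weights

variable [FiniteDimensional ℂ M] [LieAlgebra.IsKilling ℂ (lieAlg hΨ z)]
  [(cartan hΨ z).IsCartanSubalgebra]

/-- With a nondegenerate Killing form, 𝔥 acts semisimply, so generalized eigenvectors are
eigenvectors. -/
lemma rootSpace_eq_genWeightSpace (χ : Dual ℂ (cartan hΨ z)) :
    rootSpace hΨ z χ = (LieAlgebra.rootSpace (cartan hΨ z) χ).toSubmodule := by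
  ext x
  rw [mem_rootSpace]
  refine ⟨fun h ↦ (LieModule.mem_genWeightSpace _ _ _).2 fun y ↦ ⟨1, ?_⟩,
    fun h y ↦ LieAlgebra.IsKilling.lie_eq_smul_of_mem_rootSpace h y⟩
  have : ⁅y, x⁆ = χ y • x := h y
  simp [this]

lemma exists_weight_of_rootSpace_ne_bot {χ : Dual ℂ (cartan hΨ z)} (hχ : χ ≠ 0)
    (h : LieAlgebra.rootSpace (cartan hΨ z) χ ≠ ⊥) :
    ∃ α : (cartan hΨ z).root, (LieAlgebra.IsKilling.rootSystem (cartan hΨ z)).root α = χ := by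
  refine ⟨⟨⟨χ, h⟩, ?_⟩, LinearMap.ext fun _ ↦ rfl⟩
  simp only [LieSubalgebra.root, Finset.mem_filter, Finset.mem_univ, true_and]
  exact fun h0 ↦ hχ (LinearMap.coe_injective h0)

end weights

variable [P.IsRootSystem] [P.IsIrreducible]

@[simp] lemma dot_basisH (v : E) (i : b.support) :
    dot hΨ z v (basisH hΨ z i) = P.toLinearMap v (P.coroot i) := by
  exact (basisH hΨ z).constr_basis ℂ _ i

lemma dot_sub (v w : E) : dot hΨ z (v - w) = dot hΨ z v - dot hΨ z w :=
  (basisH hΨ z).ext fun i ↦ by simp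

lemma dot_smul (q : ℚ) (v : E) : dot hΨ z (q • v) = (q : ℂ) • dot hΨ z v :=
  (basisH hΨ z).ext fun i ↦ by simp

lemma dot_neg (v : E) : dot hΨ z (-v) = -dot hΨ z v :=
  (basisH hΨ z).ext fun i ↦ by simp

lemma dot_injective : Function.Injective (dot hΨ z) := fun v w h ↦ by
  refine sub_eq_zero.1 (eq_zero_of_forall_pairing_eq_zero b fun i hi ↦ ?_)
  have h1 := LinearMap.congr_fun h (basisH hΨ z ⟨i, hi⟩)
  rw [dot_basisH, dot_basisH, Rat.cast_inj] at h1
  simpa [sub_eq_zero] using h1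

lemma dot_root_ne_zero (i : ι) : dot hΨ z (P.root i) ≠ 0 := fun h ↦ by
  have : dot hΨ z (P.root i) = dot hΨ z 0 := h.trans (by rw [← sub_self (0 : E), dot_sub, sub_self])
  exact P.ne_zero i (dot_injective hΨ z this)

/-- The weights of the summands of the root decomposition. -/
def decompositionWeight : Option ι → (cartan hΨ z → ℂ)
  | none => 0
  | some i => dot hΨ z (P.root i)

lemma decompositionWeight_injective : Function.Injective (decompositionWeight hΨ z) := by
  rintro (_ | i) (_ | j) h
  · rfl
  · exact (dot_root_ne_zero hΨ z j (LinearMap.coe_injective h.symm)).elim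
  · exact (dot_root_ne_zero hΨ z i (LinearMap.coe_injective h)).elim
  · exact congrArg some (P.root.injective (dot_injective hΨ z (LinearMap.coe_injective h)))

lemma rootDecomposition_eq [FiniteDimensional ℂ M] [LieAlgebra.IsKilling ℂ (lieAlg hΨ z)]
    [(cartan hΨ z).IsCartanSubalgebra] (j : Option ι) :
    rootDecomposition hΨ z j =
      (LieAlgebra.rootSpace (cartan hΨ z) (decompositionWeight hΨ z j)).toSubmodule := by
  cases j with
  | none =>
    change (cartan hΨ z).toSubmodule = (LieAlgebra.rootSpace (cartan hΨ z) 0).toSubmodule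
    rw [LieAlgebra.rootSpace_zero_eq]
    rfl
  | some i => exact rootSpace_eq_genWeightSpace hΨ z _

variable [Finite ι] [P.IsCrystallographic]

lemma lieBasis_h'_eq (i : b.support) : (lieBasis hΨ z).h' i = basisH hΨ z i :=
  Subtype.ext (coe_basisH hΨ z i).symm

lemma baseSupp_lieBasis (i : b.support) :
    (lieBasis hΨ z).baseSupp i = dot hΨ z (P.root i) := by
  refine (basisH hΨ z).ext fun j ↦ ?_
  rw [dot_basisH, ← lieBasis_h'_eq, LieAlgebra.Basis.baseSupp_apply_h', P.root_coroot_eq_pairing,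
    ← P.algebraMap_pairingIn ℤ]
  simp [lieBasis, RootPairing.Base.cartanMatrix, RootPairing.Base.cartanMatrixIn_def]

theorem isCartanSubalgebra_cartan : (cartan hΨ z).IsCartanSubalgebra :=
  have := hΨ.finiteDimensional z
  (lieBasis hΨ z).isCartanSubalgebra

/-- This gives access to the root theory of 𝔤, which is why simplicity has to be established
beforehand without it. -/
lemma isKilling_lieAlg [P.IsReduced] : LieAlgebra.IsKilling ℂ (lieAlg hΨ z) :=
  have := hΨ.finiteDimensional z
  have := isSimple_lieAlg hΨ z
  inferInstance

/-! ### Comparison of the two root systems -/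

section roots

variable [FiniteDimensional ℂ M] [LieAlgebra.IsKilling ℂ (lieAlg hΨ z)]
  [(cartan hΨ z).IsCartanSubalgebra]

open LieAlgebra.IsKilling in
-- The coroot attached to the i-th simple root of 𝔤 is h_i, on which v̇ takes the value (v, α_i^∨).
lemma reflection_rootSystem_dot (i : b.support) (v : E) :
    (rootSystem (cartan hΨ z)).reflection ((lieBasis hΨ z).baseSupp' i) (dot hΨ z v) =
      dot hΨ z (P.reflection i v) := by
  have h1 : (rootSystem (cartan hΨ z)).coroot ((lieBasis hΨ z).baseSupp' i) = basisH hΨ z i := by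
    rw [← lieBasis_h'_eq]
    exact (lieBasis hΨ z).coroot_eq_h' i
  rw [RootPairing.reflection_apply, RootPairing.reflection_apply, dot_sub, dot_smul,
    RootPairing.coroot', RootPairing.coroot', LinearMap.flip_apply, LinearMap.flip_apply, h1,
    rootSystem_toLinearMap_apply, dot_basisH, rootSystem_root_apply]
  congr 2
  exact baseSupp_lieBasis hΨ z i

open LieAlgebra.IsKilling in
lemma exists_dot_eq_root (α : (cartan hΨ z).root) : ∃ i : ι,
    dot hΨ z (P.root i) = (rootSystem (cartan hΨ z)).root α := by
  refine (lieBasis hΨ z).base.induction_reflect α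
    (p := fun α ↦ ∃ i, dot hΨ z (P.root i) = (rootSystem (cartan hΨ z)).root α) ?_ ?_ ?_
  · rintro α ⟨i, hi⟩
    refine ⟨P.reflectionPerm i i, ?_⟩
    rw [RootPairing.root_reflectionPerm, RootPairing.reflection_apply_self, dot_neg, hi,
      RootPairing.root_reflectionPerm, RootPairing.reflection_apply_self]
  · intro α hα
    obtain ⟨i, hi⟩ := (lieBasis hΨ z).baseSupportEquiv.surjective ⟨α, hα⟩
    obtain rfl : (lieBasis hΨ z).baseSupp' i = α := congrArg Subtype.val hi
    exact ⟨i, (baseSupp_lieBasis hΨ z i).symm⟩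
  · rintro α β ⟨i, hi⟩ hβ
    obtain ⟨j, hj⟩ := (lieBasis hΨ z).baseSupportEquiv.surjective ⟨β, hβ⟩
    obtain rfl : (lieBasis hΨ z).baseSupp' j = β := congrArg Subtype.val hj
    refine ⟨P.reflectionPerm j i, ?_⟩
    rw [RootPairing.root_reflectionPerm, ← reflection_rootSystem_dot, hi,
      RootPairing.root_reflectionPerm]

lemma isInternal_rootDecomposition [DecidableEq ι] :
    DirectSum.IsInternal (rootDecomposition hΨ z) := by
  rw [DirectSum.isInternal_submodule_iff_iSupIndep_and_iSup_eq_top]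
  simp only [funext (rootDecomposition_eq hΨ z)]
  constructor
  · exact (LieSubmodule.iSupIndep_toSubmodule.2
      (LieModule.iSupIndep_genWeightSpace ℂ (cartan hΨ z) (lieAlg hΨ z))).comp
      (decompositionWeight_injective hΨ z)
  · rw [← LieSubmodule.iSup_toSubmodule, LieSubmodule.toSubmodule_eq_top, ← top_le_iff,
      ← LieModule.iSup_genWeightSpace_eq_top' ℂ (cartan hΨ z) (lieAlg hΨ z), iSup_le_iff]
    intro χ
    by_cases hχ : χ.IsZero
    · refine le_iSup_of_le none (le_of_eq ?_)
      rw [hχ]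
      rfl
    · obtain ⟨i, hi⟩ := exists_dot_eq_root hΨ z ⟨χ, by simpa using hχ⟩
      refine le_iSup_of_le (some i) (le_of_eq ?_)
      rw [decompositionWeight, hi]
      rfl

variable [P.IsReduced]

open LieAlgebra.IsKilling in
-- The converse of `exists_dot_eq_root`, with the induction run over Φ instead of over the roots of
-- 𝔤.
lemma exists_root_eq_dot (i : ι) : ∃ α : (cartan hΨ z).root,
    (rootSystem (cartan hΨ z)).root α = dot hΨ z (P.root i) := by
  refine b.induction_reflect i
    (p := fun i ↦ ∃ α, (rootSystem (cartan hΨ z)).root α = dot hΨ z (P.root i)) ?_ ?_ ?_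
  · rintro i ⟨α, hα⟩
    refine ⟨(rootSystem (cartan hΨ z)).reflectionPerm α α, ?_⟩
    rw [RootPairing.root_reflectionPerm, RootPairing.reflection_apply_self, hα,
      RootPairing.root_reflectionPerm, RootPairing.reflection_apply_self, dot_neg]
  · exact fun i hi ↦ ⟨(lieBasis hΨ z).baseSupp' ⟨i, hi⟩, baseSupp_lieBasis hΨ z ⟨i, hi⟩⟩
  · rintro i j ⟨α, hα⟩ hj
    refine ⟨(rootSystem (cartan hΨ z)).reflectionPerm ((lieBasis hΨ z).baseSupp' ⟨j, hj⟩) α, ?_⟩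
    rw [RootPairing.root_reflectionPerm, hα, reflection_rootSystem_dot,
      RootPairing.root_reflectionPerm]

lemma setOf_rootSpace_ne_bot : {χ : Dual ℂ (cartan hΨ z) | χ ≠ 0 ∧ rootSpace hΨ z χ ≠ ⊥} =
    range fun i : ι ↦ dot hΨ z (P.root i) := by
  ext χ
  simp only [mem_ofPred_eq, mem_range, rootSpace_eq_genWeightSpace, ne_eq,
    LieSubmodule.toSubmodule_eq_bot]
  constructor
  · rintro ⟨hχ, h⟩
    obtain ⟨α, rfl⟩ := exists_weight_of_rootSpace_ne_bot hΨ z hχ h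
    exact exists_dot_eq_root hΨ z α
  · rintro ⟨i, rfl⟩
    refine ⟨dot_root_ne_zero hΨ z i, ?_⟩
    obtain ⟨α, hα⟩ := exists_root_eq_dot hΨ z i
    rw [← hα]
    exact α.1.genWeightSpace_ne_bot

lemma finrank_rootSpace_dot (i : ι) : finrank ℂ (rootSpace hΨ z (dot hΨ z (P.root i))) = 1 := by
  obtain ⟨α, hα⟩ := exists_root_eq_dot hΨ z i
  rw [rootSpace_eq_genWeightSpace, ← hα]
  exact LieAlgebra.IsKilling.finrank_rootSpace_eq_one α.1
    (Finset.mem_filter.1 α.2).2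

end roots

end Minuscule

end

theorem proposition1p6 {ι E E' M : Type*} [Finite ι] [DecidableEq ι]
    [AddCommGroup E] [Module ℚ E] [AddCommGroup E'] [Module ℚ E']
    (P : RootPairing ι ℚ E E') [P.IsRootSystem] [P.IsCrystallographic] [P.IsReduced]
    [P.IsIrreducible] (b : P.Base)
    (Ψ : Set E) (hΨ : Minuscule.IsMinusculeUnion b Ψ)
    [AddCommGroup M] [Module ℂ M] (z : Module.Basis Ψ ℂ M) :
    LieAlgebra.IsSimple ℂ (Minuscule.lieAlg hΨ z) ∧
    (Minuscule.cartan hΨ z).IsCartanSubalgebra ∧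
    {χ : Module.Dual ℂ (Minuscule.cartan hΨ z) | χ ≠ 0 ∧ Minuscule.rootSpace hΨ z χ ≠ ⊥} =
      Set.range (fun i : ι ↦ Minuscule.dot hΨ z (P.root i)) ∧
    DirectSum.IsInternal (Minuscule.rootDecomposition hΨ z) ∧
    ∀ i : ι, Module.finrank ℂ (Minuscule.rootSpace hΨ z (Minuscule.dot hΨ z (P.root i))) = 1 := by
  have := hΨ.finiteDimensional z
  have := Minuscule.isKilling_lieAlg hΨ z
  have := Minuscule.isCartanSubalgebra_cartan hΨ z
  exact ⟨Minuscule.isSimple_lieAlg hΨ z, this, Minuscule.setOf_rootSpace_ne_bot hΨ z,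
    Minuscule.isInternal_rootDecomposition hΨ z, Minuscule.finrank_rootSpace_dot hΨ z⟩
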